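/- **Setting.** Let $n\ge 0$ be an integer and let $(g_{mk})_{m\in\{1,2\},\,k\in\{0,1,2\}}\in(1,2]^{2\times 3}$. Write $g_{mk}=\sum_{j\ge 0}[g_{mk}]_j2^{-j}$ for the binary expansion with $[g_{mk}]_0=1$ (for dyadic rationals, the expansion with infinitely many ones). Let $\bar G_{mk}$ be the $n\times n$ lower-triangular Toeplitz matrix over $\mathbb{Z}_2$ with ones on the diagonal and entry $[g_{mk}]_{i-j}$ in row $i$, column $j$ for $i>j$. The (modulated) symmetric lower-triangular deterministic X-channel has inputs $\bar u_{mk}\in\mathbb{Z}_2^n$ ($m,k\in\{1,2\}$) and outputs $$\bar y_1=\bar G_{11}\bar u_{11}\oplus\bar G_{12}\bar u_{12}\oplus\bar G_{10}(\bar u_{21}\oplus\bar u_{22}),\qquad \bar y_2=\bar G_{22}\bar u_{22}\oplus\bar G_{21}\bar u_{21}\oplus\bar G_{20}(\bar u_{12}\oplus\bar u_{11}).$$ There are four independent uniformly distributed messages $w_{mk}$, $m,k\in\{1,2\}$. Over a block of $T$ channel uses, each $w_{mk}$ is encoded separately into the sequence of inputs $\bar u_{mk}$, and receiver $m$ must decode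 $w_{m1}$ and $w_{m2}$ from its $T$ received vectors. A tuple of nonnegative rates $(\bar R_{mk})$ is achievable if there are codes of all block lengths $T$, with $\lceil 2^{T\bar R_{mk}}\rceil$ values of the message $w_{mk}$, whose probability of error (some receiver decodes some desired message wrongly) tends to $0$ as $T\to\infty$. The sum capacity $\bar C(n)$, which depends on $(g_{mk})$, is the supremum of $\bar R_{11}+\bar R_{12}+\bar R_{21}+\bar R_{22}$ over all achievable tuples. **Theorem.** There is a universal constant $c_1>0$ such that for every $\delta\in(0,1]$ and every integer $n\ge 0$ there exists a measurable set $B_n\subseteq(1,2]^{2\times 3}$ of Lebesgue measure $\mu(B_n)\le\delta$ such that, for all channel gains $(g_{mk})\in(1,2]^{2\times 3}\setminus B_n$, $$\tfrac43 n-2\log_2(c_1/\delta)\;\le\;\bar C(n)\;\le\;\tfrac43 n .$$ -/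

import Mathlib

noncomputable section

namespace XChannel

/-- The digit `[g]_j` of the binary expansion `g = ∑_{j ≥ 0} [g]_j 2^{-j}` of a number
`g ∈ (1, 2]`, as an element of `ℤ/2`. For dyadic rationals (a null set) the expansion with
infinitely many ones is taken; this is the one for which `[g]_0 = 1` on all of `(1, 2]`,
including `g = 2 = 1.111…`. -/
def binDigit (g : ℝ) (j : ℕ) : ZMod 2 :=
  ((⌈(2 : ℝ) ^ j * g⌉ - 1 : ℤ) : ZMod 2)

/-- The `n × n` lower-triangular binary Toeplitz matrix of the channel gain `g`: ones on the
diagonal, and `[g]_{i-j}` in row `i`, column `j` below it. -/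
def gainMatrix (n : ℕ) (g : ℝ) : Matrix (Fin n) (Fin n) (ZMod 2) :=
  Matrix.of fun i j =>
    if i < j then 0 else if i = j then 1 else binDigit g ((i : ℕ) - (j : ℕ))

open scoped Matrix in
/-- One use of the symmetric deterministic X-channel. The gain `g_{mk}`, `m ∈ {1,2}`,
`k ∈ {0,1,2}`, is `g (m-1) k`; the input `u_{mk}`, `m, k ∈ {1,2}`, is `u (m-1) (k-1)`; the
value at `m-1` is the vector received by receiver `m`. All operations are over `ℤ/2`. -/
def channelOutput (n : ℕ) (g : Fin 2 → Fin 3 → ℝ) (u : Fin 2 → Fin 2 → Fin n → ZMod 2) :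
    Fin 2 → Fin n → ZMod 2 :=
  ![gainMatrix n (g 0 1) *ᵥ u 0 0 + gainMatrix n (g 0 2) *ᵥ u 0 1
      + gainMatrix n (g 0 0) *ᵥ (u 1 0 + u 1 1),
    gainMatrix n (g 1 2) *ᵥ u 1 1 + gainMatrix n (g 1 1) *ᵥ u 1 0
      + gainMatrix n (g 1 0) *ᵥ (u 0 1 + u 0 0)]

/-- A block code of length `T` with `M m k` possible values of the message `w_{mk}` from
transmitter `k` to receiver `m`. Each of the four messages has its own encoder; receiver `m`
estimates the messages `w_{m1}` and `w_{m2}` from its `T` received vectors. -/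
structure Code (n T : ℕ) (M : Fin 2 → Fin 2 → ℕ) where
  /-- The encoder of message `w_{mk}`: the channel inputs `u_{mk}[t]`, `t < T`. -/
  enc : ∀ m k : Fin 2, Fin (M m k) → Fin T → Fin n → ZMod 2
  /-- The decoder of receiver `m`: the estimates of `w_{mk}` for `k = 1, 2`. -/
  dec : ∀ m : Fin 2, (Fin T → Fin n → ZMod 2) → ∀ k : Fin 2, Fin (M m k)

/-- The sequence of vectors received by receiver `m` if the messages `w` are sent. -/
def Code.received {n T : ℕ} {M : Fin 2 → Fin 2 → ℕ} (C : Code n T M) (g : Fin 2 → Fin 3 → ℝ)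
    (w : ∀ m k : Fin 2, Fin (M m k)) (m : Fin 2) : Fin T → Fin n → ZMod 2 :=
  fun t => channelOutput n g (fun m' k' => C.enc m' k' (w m' k') t) m

open scoped Classical in
/-- The average probability of error: the probability that some receiver decodes one of its
messages wrongly if the four messages are independent and uniformly distributed. -/
def Code.errorProb {n T : ℕ} {M : Fin 2 → Fin 2 → ℕ} (C : Code n T M)
    (g : Fin 2 → Fin 3 → ℝ) : ℝ :=
  ((Finset.univ.filter fun w : (∀ m k : Fin 2, Fin (M m k)) =>
      ∃ m k, C.dec m (C.received g w m) k ≠ w m k).card : ℝ)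
    / (Fintype.card (∀ m k : Fin 2, Fin (M m k)) : ℝ)

/-- The rate tuple `R = (R_{mk})`, in bits per channel use, is achievable: there are codes of
all block lengths `T`, with `⌈2^{T R_{mk}}⌉` values of the message `w_{mk}`, whose average
probability of error vanishes as `T → ∞`. -/
def Achievable (n : ℕ) (g : Fin 2 → Fin 3 → ℝ) (R : Fin 2 → Fin 2 → ℝ) : Prop :=
  (∀ m k, 0 ≤ R m k) ∧
  ∃ C : ∀ T : ℕ, Code n T (fun m k => ⌈(2 : ℝ) ^ ((T : ℝ) * R m k)⌉₊),
    Filter.Tendsto (fun T => (C T).errorProb g) Filter.atTop (nhds 0)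

/-- The sum capacity of the symmetric deterministic X-channel with gains `g`: the supremum of
the sum rates of achievable rate tuples, taken in the extended reals so that it is the actual
least upper bound in every case. -/
def sumCapacity (n : ℕ) (g : Fin 2 → Fin 3 → ℝ) : EReal :=
  sSup {s : EReal | ∃ R : Fin 2 → Fin 2 → ℝ,
    Achievable n g R ∧ s = ((∑ m, ∑ k, R m k : ℝ) : EReal)}

/-- The set `(1, 2]^{2 × 3}` of channel gains. -/
def gainBox : Set (Fin 2 → Fin 3 → ℝ) :=
  {g | ∀ m k, g m k ∈ Set.Ioc (1 : ℝ) 2}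

end XChannel

end

namespace XChannel

open scoped Matrix ENNReal
open MeasureTheory

/-! Upper bound: give receiver `m` one of the two messages meant for the other receiver. After
decoding its own messages and inverting the unit-triangular interference matrix, it knows the sum of
the two interfering codewords, hence both codewords, hence the other receiver's output. So `n` bits
per use carry the other three messages (`Achievable.sum_sub_le`); adding the four such bounds gives
`3 * sum ≤ 4 * n`.

Lower bound: send each message uncoded on the first `d ≈ n / 3` coordinates. The two interferers
pass through the same matrix and align, so each receiver separates only three blocks of length `d`.
This fails only if a nonzero triple of blocks is sent to zero. If the triple starts at coordinate
`v`, this fixes the first digits of one gain once the other two are given, which has probability at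
most `2 ^ (-(n - 1 - v))`. There are at most `2 ^ (3 * (d - v))` such triples, and a union bound
over `v` (`pi_confusing_le`) makes failure rare. -/

theorem channelOutput_apply (n : ℕ) (g : Fin 2 → Fin 3 → ℝ) (u : Fin 2 → Fin 2 → Fin n → ZMod 2)
    (m : Fin 2) :
    channelOutput n g u m = gainMatrix n (g m 0) *ᵥ (u (1 - m) 0 + u (1 - m) 1)
      + gainMatrix n (g m 1) *ᵥ u m 0 + gainMatrix n (g m 2) *ᵥ u m 1 := by
  fin_cases m
  · simp only [channelOutput, Fin.zero_eta, Matrix.cons_val_zero, sub_zero]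
    abel
  · simp only [channelOutput, Fin.mk_one, Matrix.cons_val_one, Matrix.cons_val_zero, sub_self]
    rw [add_comm (u 0 1)]
    abel

theorem det_gainMatrix (n : ℕ) (g : ℝ) : (gainMatrix n g).det = 1 := by
  rw [Matrix.det_of_isLowerTriangular]
  · simp [gainMatrix]
  · intro i j hij
    have : i < j := by simpa using hij
    simp [gainMatrix, this]

theorem gainMatrix_mulVec_injective (n : ℕ) (g : ℝ) :
    Function.Injective (gainMatrix n g).mulVec := by
  rw [Matrix.mulVec_injective_iff_isUnit, Matrix.isUnit_iff_isUnit_det, det_gainMatrix]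
  exact isUnit_one

/-! ### Converse: three of the four messages share `n` bits -/

section Converse

variable {n T : ℕ} {M : Fin 2 → Fin 2 → ℕ} (C : Code n T M) (g : Fin 2 → Fin 3 → ℝ)

theorem Code.received_apply (w : ∀ m k : Fin 2, Fin (M m k)) (m : Fin 2) (t : Fin T) :
    C.received g w m t =
      gainMatrix n (g m 0) *ᵥ (C.enc (1 - m) 0 (w (1 - m) 0) t + C.enc (1 - m) 1 (w (1 - m) 1) t)
      + gainMatrix n (g m 1) *ᵥ C.enc m 0 (w m 0) t
      + gainMatrix n (g m 2) *ᵥ C.enc m 1 (w m 1) t :=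
  channelOutput_apply _ _ _ _

/-- A message tuple that is decoded without error is determined by what receiver `m` receives
together with one of the two messages meant for the other receiver. -/
theorem Code.eq_of_received_eq {w w' : ∀ m k : Fin 2, Fin (M m k)} (m j : Fin 2)
    (hw : ∀ m k, C.dec m (C.received g w m) k = w m k)
    (hw' : ∀ m k, C.dec m (C.received g w' m) k = w' m k)
    (hr : C.received g w m = C.received g w' m) (hj : w (1 - m) j = w' (1 - m) j) : w = w' := by
  have hm : ∀ k, w m k = w' m k := fun k => by rw [← hw, ← hw', hr]
  have hsum : ∀ t, C.enc (1 - m) 0 (w (1 - m) 0) t + C.enc (1 - m) 1 (w (1 - m) 1) t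
      = C.enc (1 - m) 0 (w' (1 - m) 0) t + C.enc (1 - m) 1 (w' (1 - m) 1) t := by
    intro t
    have ht := congrFun hr t
    rw [C.received_apply, C.received_apply, hm 0, hm 1] at ht
    exact gainMatrix_mulVec_injective _ _ (add_right_cancel (add_right_cancel ht))
  -- Only codewords are compared here: encoders need not be injective, so the messages themselves
  -- agree only after the other receiver decodes.
  have henc : ∀ k t, C.enc (1 - m) k (w (1 - m) k) t = C.enc (1 - m) k (w' (1 - m) k) t := by
    intro k t
    have ht := hsum t
    fin_cases j <;> fin_cases k <;> simp_all
  have hr' : C.received g w (1 - m) = C.received g w' (1 - m) := by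
    funext t
    rw [C.received_apply, C.received_apply, henc, henc, sub_sub_cancel, hm, hm]
  have hm' : ∀ k, w (1 - m) k = w' (1 - m) k := fun k => by rw [← hw, ← hw', hr']
  funext i k
  obtain rfl | rfl : i = m ∨ i = 1 - m := by clear * -; decide +revert
  · exact hm k
  · exact hm' k

open scoped Classical in
/-- The message tuples that both receivers decode without error. -/
noncomputable def Code.correct : Finset (∀ m k : Fin 2, Fin (M m k)) :=
  Finset.univ.filter fun w => ∀ m k, C.dec m (C.received g w m) k = w m k

theorem Code.card_correct_le (m j : Fin 2) :
    (C.correct g).card ≤ M (1 - m) j * 2 ^ (n * T) := by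
  have h := Finset.card_le_card_of_injOn (s := C.correct g)
    (t := (Finset.univ : Finset (Fin (M (1 - m) j) × (Fin T → Fin n → ZMod 2))))
    (fun w => (w (1 - m) j, C.received g w m)) (fun _ _ => by simp) (by
      intro w hw w' hw' h
      simp only [Code.correct, Finset.coe_filter, Finset.mem_univ, true_and,
        Set.mem_ofPred_eq] at hw hw'
      simp only [Prod.mk.injEq] at h
      exact C.eq_of_received_eq g m j hw hw' h.2 h.1)
  simpa [← pow_mul] using h

theorem Code.one_sub_errorProb (hM : ∀ m k, 0 < M m k) :
    1 - C.errorProb g = ((C.correct g).card : ℝ) / ∏ p : Fin 2 × Fin 2, (M p.1 p.2 : ℝ) := by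
  classical
  have hcard : (Fintype.card (∀ m k : Fin 2, Fin (M m k)) : ℝ)
      = ∏ p : Fin 2 × Fin 2, (M p.1 p.2 : ℝ) := by
    simp [Fintype.prod_prod_type]
  have hpos : (0 : ℝ) < ∏ p : Fin 2 × Fin 2, (M p.1 p.2 : ℝ) :=
    Finset.prod_pos fun p _ => by exact_mod_cast hM p.1 p.2
  have hsplit := Finset.card_filter_add_card_filter_not
    (s := (Finset.univ : Finset (∀ m k : Fin 2, Fin (M m k))))
    (fun w => ∃ m k, C.dec m (C.received g w m) k ≠ w m k)
  have hc : (C.correct g) = Finset.univ.filter fun w : (∀ m k : Fin 2, Fin (M m k)) =>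
      ¬ ∃ m k, C.dec m (C.received g w m) k ≠ w m k := by
    ext w
    simp [Code.correct]
  rw [← hc, Finset.card_univ] at hsplit
  rw [Code.errorProb, hcard, eq_div_iff hpos.ne', sub_mul, div_mul_cancel₀ _ hpos.ne', one_mul,
    ← hcard, ← hsplit]
  push_cast
  ring

end Converse

/-- If the sum of the three rates were some `s > n`, the success probability would be at most `2 ^
((n - s) * T)`, which tends to zero: a strong-converse count of correctly decoded tuples, without
entropy. -/
theorem Achievable.sum_sub_le {n : ℕ} {g : Fin 2 → Fin 3 → ℝ} {R : Fin 2 → Fin 2 → ℝ}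
    (h : Achievable n g R) (m j : Fin 2) : (∑ i, ∑ k, R i k) - R (1 - m) j ≤ n := by
  obtain ⟨-, C, hC⟩ := h
  set s : ℝ := (∑ i, ∑ k, R i k) - R (1 - m) j with hs
  by_contra! hlt
  have hbound : ∀ T : ℕ, 1 - (C T).errorProb g ≤ ((2 : ℝ) ^ ((n : ℝ) - s)) ^ T := by
    intro T
    have hM : ∀ i k, 0 < ⌈(2 : ℝ) ^ ((T : ℝ) * R i k)⌉₊ := fun i k =>
      Nat.ceil_pos.2 (by positivity)
    rw [(C T).one_sub_errorProb g hM]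
    have hprod : (2 : ℝ) ^ ((T : ℝ) * s) ≤ ∏ p ∈ Finset.univ.erase ((1 - m, j) : Fin 2 × Fin 2),
        (⌈(2 : ℝ) ^ ((T : ℝ) * R p.1 p.2)⌉₊ : ℝ) := by
      have : s = ∑ p ∈ Finset.univ.erase ((1 - m, j) : Fin 2 × Fin 2), R p.1 p.2 := by
        rw [hs, ← Fintype.sum_prod_type' (f := fun i k => R i k),
          ← Finset.add_sum_erase _ _ (Finset.mem_univ ((1 - m, j) : Fin 2 × Fin 2))]
        simp
      rw [this, Finset.mul_sum, Real.rpow_sum_of_pos two_pos]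
      exact Finset.prod_le_prod (fun _ _ => by positivity) fun _ _ => Nat.le_ceil _
    have hcard : (((C T).correct g).card : ℝ)
        ≤ ⌈(2 : ℝ) ^ ((T : ℝ) * R (1 - m) j)⌉₊ * 2 ^ (n * T) := by
      exact_mod_cast (C T).card_correct_le g m j
    have hMpos : (0 : ℝ) < ⌈(2 : ℝ) ^ ((T : ℝ) * R (1 - m) j)⌉₊ := by exact_mod_cast hM _ _
    rw [← Finset.mul_prod_erase _ _ (Finset.mem_univ ((1 - m, j) : Fin 2 × Fin 2))]
    have h2 : (0 : ℝ) < (2 : ℝ) ^ ((T : ℝ) * s) := by positivity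
    calc _ ≤ (⌈(2 : ℝ) ^ ((T : ℝ) * R (1 - m) j)⌉₊ * 2 ^ (n * T) : ℝ)
          / (⌈(2 : ℝ) ^ ((T : ℝ) * R (1 - m) j)⌉₊ * (2 : ℝ) ^ ((T : ℝ) * s)) := by
            gcongr
      _ = 2 ^ (n * T) / (2 : ℝ) ^ ((T : ℝ) * s) := mul_div_mul_left _ _ hMpos.ne'
      _ = ((2 : ℝ) ^ ((n : ℝ) - s)) ^ T := by
        rw [← Real.rpow_natCast, ← Real.rpow_natCast, ← Real.rpow_mul two_pos.le,
          ← Real.rpow_sub two_pos]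
        congr 1
        push_cast
        ring
  have hlim := tendsto_pow_atTop_nhds_zero_of_lt_one (r := (2 : ℝ) ^ ((n : ℝ) - s)) (by positivity)
    (Real.rpow_lt_one_of_one_lt_of_neg one_lt_two (by linarith))
  have := le_of_tendsto_of_tendsto' (hC.const_sub 1) hlim hbound
  norm_num at this

theorem sumCapacity_le (n : ℕ) (g : Fin 2 → Fin 3 → ℝ) :
    sumCapacity n g ≤ (((4 / 3 : ℝ) * (n : ℝ) : ℝ) : EReal) := by
  refine sSup_le ?_
  rintro _ ⟨R, hR, rfl⟩
  rw [EReal.coe_le_coe_iff]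
  have h00 := hR.sum_sub_le 0 0
  have h01 := hR.sum_sub_le 0 1
  have h10 := hR.sum_sub_le 1 0
  have h11 := hR.sum_sub_le 1 1
  simp only [Fin.sum_univ_two, sub_zero, sub_self] at *
  linarith

/-! ### Binary digits of a gain read off from a Toeplitz product -/

theorem binDigit_zero {g : ℝ} (hg : g ∈ Set.Ioc (1 : ℝ) 2) : binDigit g 0 = 1 := by
  have : ⌈g⌉ = 2 := by
    rw [Int.ceil_eq_iff]
    constructor <;> norm_num <;> linarith [hg.1, hg.2]
  simp [binDigit, this]

theorem gainMatrix_apply {n : ℕ} {g : ℝ} (hg : g ∈ Set.Ioc (1 : ℝ) 2) (i j : Fin n) :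
    gainMatrix n g i j = if i < j then 0 else binDigit g (i - j) := by
  by_cases h : i = j
  · simp [gainMatrix, h, binDigit_zero hg]
  · simp [gainMatrix, h]

theorem ceil_two_mul (x : ℝ) : ⌈2 * x⌉ = 2 * ⌈x⌉ - 1 ∨ ⌈2 * x⌉ = 2 * ⌈x⌉ := by
  have h1 := Int.le_ceil x
  have h2 := Int.ceil_lt_add_one x
  have h3 : ⌈2 * x⌉ ≤ 2 * ⌈x⌉ := by
    rw [Int.ceil_le]; push_cast; linarith
  have h4 : 2 * ⌈x⌉ - 2 < ⌈2 * x⌉ := by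
    rw [Int.lt_ceil]; push_cast; linarith
  omega

/-- The first digits of the expansion determine the dyadic interval that contains the number. -/
theorem ceil_eq_of_binDigit_eq {g g' : ℝ} (hg : g ∈ Set.Ioc (1 : ℝ) 2)
    (hg' : g' ∈ Set.Ioc (1 : ℝ) 2) (J : ℕ) (h : ∀ j ≤ J, binDigit g j = binDigit g' j) :
    ⌈(2 : ℝ) ^ J * g⌉ = ⌈(2 : ℝ) ^ J * g'⌉ := by
  induction J with
  | zero =>
    have : ∀ {x : ℝ}, x ∈ Set.Ioc (1 : ℝ) 2 → ⌈x⌉ = 2 := fun hx => by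
      rw [Int.ceil_eq_iff]
      constructor <;> norm_num <;> linarith [hx.1, hx.2]
    simp [this hg, this hg']
  | succ J ih =>
    have hJ := ih fun j hj => h j (by omega)
    have hd := h (J + 1) le_rfl
    rw [binDigit, binDigit, ZMod.intCast_eq_intCast_iff_dvd_sub] at hd
    have e1 : (2 : ℝ) ^ (J + 1) * g = 2 * (2 ^ J * g) := by ring
    have e2 : (2 : ℝ) ^ (J + 1) * g' = 2 * (2 ^ J * g') := by ring
    rw [e1, e2] at hd ⊢
    have h1 := ceil_two_mul (2 ^ J * g)
    have h2 := ceil_two_mul (2 ^ J * g')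
    push_cast at hd
    omega

/-- The output of a Toeplitz matrix for an input that starts at coordinate `v` determines the
first `n - 1 - v` digits of the gain. -/
theorem binDigit_eq_of_mulVec_eq {n : ℕ} {g g' : ℝ} (hg : g ∈ Set.Ioc (1 : ℝ) 2)
    (hg' : g' ∈ Set.Ioc (1 : ℝ) 2) {a : Fin n → ZMod 2} {v : Fin n} (hv : a v ≠ 0)
    (hlt : ∀ i < v, a i = 0) (h : gainMatrix n g *ᵥ a = gainMatrix n g' *ᵥ a) :
    ∀ j ≤ n - 1 - (v : ℕ), binDigit g j = binDigit g' j := by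
  intro j
  induction j using Nat.strong_induction_on with
  | _ j ih =>
    intro hj
    have hvn := v.isLt
    -- In row `v + j`, column `v` carries digit `j`, later columns carry earlier digits, already
    -- known to agree, and earlier columns meet zeros of `a`.
    let r : Fin n := ⟨v + j, by omega⟩
    have hr := congrFun h r
    have hdiff : ∑ i, (gainMatrix n g r i - gainMatrix n g' r i) * a i = 0 := by
      simp only [sub_mul, Finset.sum_sub_distrib]
      exact sub_eq_zero.2 hr
    rw [Finset.sum_eq_single v] at hdiff
    · have hnot : ¬ r < v := by simp [r, Fin.lt_def]
      have hrv : (r : ℕ) - (v : ℕ) = j := by simp [r]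
      rw [gainMatrix_apply hg, gainMatrix_apply hg', if_neg hnot, if_neg hnot, hrv] at hdiff
      exact sub_eq_zero.1 ((mul_eq_zero.1 hdiff).resolve_right hv)
    · intro i _ hi
      rcases lt_or_gt_of_ne hi with hi | hi
      · rw [hlt i hi, mul_zero]
      · rw [gainMatrix_apply hg, gainMatrix_apply hg']
        by_cases hri : r < i
        · simp [hri]
        · have hi' : (v : ℕ) < i := hi
          have hri' : (i : ℕ) ≤ v + j := not_lt.1 hri
          have hd : binDigit g ((r : ℕ) - i) = binDigit g' ((r : ℕ) - i) :=
            ih _ (by simp only [r]; omega) (by simp only [r]; omega)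
          simp [hri, hd]
    · simp

theorem volume_ceil_eq_le (J : ℕ) (N : ℤ) :
    volume {x : ℝ | ⌈(2 : ℝ) ^ J * x⌉ = N} ≤ (2⁻¹ : ℝ≥0∞) ^ J := by
  have h2 : (0 : ℝ) < 2 ^ J := by positivity
  have : {x : ℝ | ⌈(2 : ℝ) ^ J * x⌉ = N} ⊆ Set.Ioc ((N - 1) / 2 ^ J : ℝ) (N / 2 ^ J) := by
    intro x hx
    rw [Set.mem_ofPred_eq, Int.ceil_eq_iff] at hx
    rw [Set.mem_Ioc, div_lt_iff₀ h2, le_div_iff₀ h2]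
    constructor <;> linarith [hx.1, hx.2]
  refine (measure_mono this).trans ?_
  rw [Real.volume_Ioc, show (N / 2 ^ J - (N - 1) / 2 ^ J : ℝ) = (2⁻¹ : ℝ) ^ J by
    rw [inv_pow]; field_simp; ring, ENNReal.ofReal_pow (by norm_num),
    ENNReal.ofReal_inv_of_pos two_pos]
  simp

/-! ### Probability that a fixed signal vanishes at a receiver -/

/-- The uniform distribution of a channel gain. -/
noncomputable def gainMeasure : Measure ℝ := volume.restrict (Set.Ioc (1 : ℝ) 2)

instance : IsProbabilityMeasure gainMeasure :=
  ⟨by rw [gainMeasure, Measure.restrict_apply_univ, Real.volume_Ioc]; norm_num⟩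

theorem gainMeasure_mulVec_eq_le {n : ℕ} {a : Fin n → ZMod 2} {v : Fin n} (hv : a v ≠ 0)
    (hlt : ∀ i < v, a i = 0) (c : Fin n → ZMod 2) :
    gainMeasure {x | gainMatrix n x *ᵥ a = c} ≤ (2⁻¹ : ℝ≥0∞) ^ (n - 1 - (v : ℕ)) := by
  rw [gainMeasure, Measure.restrict_apply' measurableSet_Ioc]
  rcases Set.eq_empty_or_nonempty ({x | gainMatrix n x *ᵥ a = c} ∩ Set.Ioc (1 : ℝ) 2) with h | h
  · simp [h]
  · obtain ⟨y, hyc, hy⟩ := h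
    refine (measure_mono ?_).trans (volume_ceil_eq_le (n - 1 - v) ⌈(2 : ℝ) ^ (n - 1 - v : ℕ) * y⌉)
    rintro x ⟨hxc, hx⟩
    exact ceil_eq_of_binDigit_eq hx hy _
      (binDigit_eq_of_mulVec_eq hx hy hv hlt (hxc.trans hyc.symm))

theorem measurable_binDigit (j : ℕ) : Measurable fun g => binDigit g j := by
  have : Measurable fun z : ℤ => ((z - 1 : ℤ) : ZMod 2) := measurable_from_top
  exact this.comp (Int.measurable_ceil.comp (measurable_const_mul _))

theorem measurable_gainMatrix_apply (n : ℕ) (i j : Fin n) :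
    Measurable fun g => gainMatrix n g i j := by
  simp only [gainMatrix, Matrix.of_apply]
  split_ifs
  · exact measurable_const
  · exact measurable_const
  · exact measurable_binDigit _

/-- The signal at a receiver with gains `x` for effective inputs `A`. -/
noncomputable def superpose (n : ℕ) (x : Fin 3 → ℝ) (A : Fin 3 → Fin n → ZMod 2) : Fin n → ZMod 2 :=
  ∑ k, gainMatrix n (x k) *ᵥ A k

theorem measurable_superpose (n : ℕ) (A : Fin 3 → Fin n → ZMod 2) :
    Measurable fun x => superpose n x A := by
  refine measurable_pi_iff.2 fun i => ?_
  simp only [superpose, Finset.sum_apply, Matrix.mulVec, dotProduct]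
  refine Finset.measurable_sum _ fun k _ => Finset.measurable_sum _ fun j _ => ?_
  exact ((measurable_gainMatrix_apply n i j).comp (measurable_pi_apply k)).mul_const _

theorem measurableSet_superpose_eq_zero (n : ℕ) (A : Fin 3 → Fin n → ZMod 2) :
    MeasurableSet {x | superpose n x A = 0} :=
  measurable_superpose n A (measurableSet_singleton 0)

/-- Fubini bound: a measurable event whose sections along one coordinate are all small. -/
theorem pi_le_of_section_le {N : ℕ} (μ : Fin (N + 1) → Measure ℝ)
    [∀ i, IsProbabilityMeasure (μ i)] (i : Fin (N + 1)) {S : Set (Fin (N + 1) → ℝ)}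
    (hS : MeasurableSet S) {ε : ℝ≥0∞}
    (h : ∀ y : Fin N → ℝ, μ i {t | i.insertNth t y ∈ S} ≤ ε) : Measure.pi μ S ≤ ε := by
  have hmp := (measurePreserving_piFinSuccAbove μ i).symm
  rw [← hmp.measure_preimage hS.nullMeasurableSet,
    Measure.prod_apply_symm (hmp.measurable hS)]
  refine (lintegral_mono (g := fun _ => ε) fun y => ?_).trans (by simp)
  exact h y

/-- Freeze all gains except one whose input is nonzero at the common leading index `v`; the equation
then prescribes that gain's Toeplitz product. -/
theorem pi_superpose_eq_zero_le {n : ℕ} {A : Fin 3 → Fin n → ZMod 2} {v : Fin n}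
    (hlt : ∀ k, ∀ i : Fin n, i < v → A k i = 0) (hv : ∃ k, A k v ≠ 0) :
    Measure.pi (fun _ : Fin 3 => gainMeasure) {x | superpose n x A = 0}
      ≤ (2⁻¹ : ℝ≥0∞) ^ (n - 1 - (v : ℕ)) := by
  obtain ⟨k, hk⟩ := hv
  refine pi_le_of_section_le _ k (measurableSet_superpose_eq_zero n A) fun y => ?_
  refine (measure_mono ?_).trans (gainMeasure_mulVec_eq_le hk (hlt k)
    (-∑ i, gainMatrix n (y i) *ᵥ A (k.succAbove i)))
  intro t ht
  simp only [Set.mem_ofPred_eq, superpose, Fin.sum_univ_succAbove _ k, Fin.insertNth_apply_same,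
    Fin.insertNth_apply_succAbove] at ht
  exact eq_neg_of_add_eq_zero_left ht

/-! ### Union bound over confusable inputs -/

/-- Gains for which two choices of effective inputs supported on the first `d` coordinates are
confused. -/
noncomputable def confusing (n d : ℕ) : Set (Fin 3 → ℝ) :=
  {x | ∃ A : Fin 3 → Fin n → ZMod 2, A ≠ 0 ∧ (∀ k (i : Fin n), d ≤ (i : ℕ) → A k i = 0) ∧
    superpose n x A = 0}

/-- Padding by zeros of a block placed at coordinate `v`. -/
noncomputable def padAt (n v l : ℕ) (a : Fin l → ZMod 2) : Fin n → ZMod 2 :=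
  fun i => if h : v ≤ (i : ℕ) ∧ (i : ℕ) - v < l then a ⟨i - v, h.2⟩ else 0

theorem exists_padAt_eq {n d : ℕ} (v : Fin n) {a : Fin n → ZMod 2} (hlt : ∀ i < v, a i = 0)
    (hd : ∀ i : Fin n, d ≤ (i : ℕ) → a i = 0) : ∃ b, padAt n v (d - v) b = a := by
  refine ⟨fun i => if h : v + (i : ℕ) < n then a ⟨v + i, h⟩ else 0, ?_⟩
  funext i
  unfold padAt
  split_ifs with h
  · have : (v : ℕ) + (i - v) = i := by omega
    simp [this]
  · by_cases hi : i < v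
    · exact (hlt i hi).symm
    · have : (v : ℕ) ≤ i := not_lt.1 hi
      exact (hd i (by omega)).symm

theorem exists_leading_index {n : ℕ} {A : Fin 3 → Fin n → ZMod 2} (hA : A ≠ 0) :
    ∃ v : Fin n, (∀ k, ∀ i : Fin n, i < v → A k i = 0) ∧ ∃ k, A k v ≠ 0 := by
  obtain ⟨k, hk⟩ := Function.ne_iff.1 hA
  obtain ⟨i, hi⟩ := Function.ne_iff.1 hk
  obtain ⟨v, hv, hmin⟩ := WellFounded.has_min (wellFounded_lt (α := Fin n))
    {i | ∃ k, A k i ≠ 0} ⟨i, k, hi⟩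
  refine ⟨v, fun k i hiv => ?_, hv⟩
  by_contra h
  exact hmin i ⟨k, h⟩ hiv

theorem measurableSet_confusing (n d : ℕ) : MeasurableSet (confusing n d) := by
  have : confusing n d = ⋃ A : {A : Fin 3 → Fin n → ZMod 2 //
      A ≠ 0 ∧ ∀ k (i : Fin n), d ≤ (i : ℕ) → A k i = 0}, {x | superpose n x A = 0} := by
    ext x
    simp [confusing, and_assoc]
  rw [this]
  exact MeasurableSet.iUnion fun A => measurableSet_superpose_eq_zero n A

/-- Sorting by leading index is essential: a late start weakens the probability bound by `2 ^ v`,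
but the number of candidates drops by `2 ^ (3 * v)`. -/
theorem confusing_subset (n d : ℕ) :
    confusing n d ⊆ ⋃ v : {v : Fin n // (v : ℕ) < d}, ⋃ b : Fin 3 → Fin (d - v) → ZMod 2,
      {x | ((∀ k, ∀ i : Fin n, i < v → padAt n v (d - v) (b k) i = 0) ∧
          ∃ k, padAt n v (d - v) (b k) v ≠ 0) ∧
        superpose n x (fun k => padAt n v (d - v) (b k)) = 0} := by
  rintro x ⟨A, hA, hd, hx⟩
  obtain ⟨v, hlt, hv⟩ := exists_leading_index hA
  have hvd : (v : ℕ) < d := by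
    by_contra h
    obtain ⟨k, hk⟩ := hv
    exact hk (hd k v (not_lt.1 h))
  choose b hb using fun k => exists_padAt_eq v (hlt k) (hd k)
  simp only [Set.mem_iUnion]
  refine ⟨⟨v, hvd⟩, b, ?_⟩
  simp only [Set.mem_ofPred_eq, hb]
  exact ⟨⟨hlt, hv⟩, hx⟩

theorem pi_confusing_le_sum (n d : ℕ) :
    Measure.pi (fun _ : Fin 3 => gainMeasure) (confusing n d)
      ≤ ∑ v : {v : Fin n // (v : ℕ) < d}, 2 ^ (3 * (d - v : ℕ)) * (2⁻¹ : ℝ≥0∞) ^ (n - 1 - v : ℕ) := by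
  refine (measure_mono (confusing_subset n d)).trans ((measure_iUnion_fintype_le _ _).trans ?_)
  refine Finset.sum_le_sum fun v _ => (measure_iUnion_fintype_le _ _).trans ?_
  refine (Finset.sum_le_sum (g := fun _ => (2⁻¹ : ℝ≥0∞) ^ (n - 1 - v : ℕ)) fun b _ => ?_).trans ?_
  · by_cases h : (∀ k, ∀ i : Fin n, i < v → padAt n v (d - v) (b k) i = 0) ∧
        ∃ k, padAt n v (d - v) (b k) v ≠ 0
    · exact (measure_mono fun x hx => hx.2).trans (pi_superpose_eq_zero_le h.1 h.2)
    · simp [h]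
  · simp [← pow_mul, mul_comm]

theorem pi_confusing_le {n d : ℕ} (hd : d ≤ n) :
    Measure.pi (fun _ : Fin 3 => gainMeasure) (confusing n d)
      ≤ 2 ^ (3 * d + 2) * (2⁻¹ : ℝ≥0∞) ^ n := by
  have hc : (2 : ℝ≥0∞) * 2⁻¹ = 1 := ENNReal.mul_inv_cancel two_ne_zero ENNReal.ofNat_ne_top
  refine (pi_confusing_le_sum n d).trans ?_
  have hterm : ∀ v : {v : Fin n // (v : ℕ) < d},
      2 ^ (3 * (d - v : ℕ)) * (2⁻¹ : ℝ≥0∞) ^ (n - 1 - v : ℕ)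
        ≤ 2 ^ (3 * d + 1) * 2⁻¹ ^ n * 2⁻¹ ^ (v : ℕ) := by
    rintro ⟨⟨v, hvn⟩, hvd⟩
    obtain ⟨e, rfl⟩ := Nat.exists_eq_add_of_lt hvd
    obtain ⟨f, rfl⟩ := Nat.exists_eq_add_of_lt hvn
    have h1 : v + e + 1 - v = e + 1 := by omega
    have h2 : v + f + 1 - 1 - v = f := by omega
    simp only [h1, h2]
    -- The true decay is `2 ^ (-2 * v)`; giving away a factor `2 ^ v` leaves a geometric series with
    -- sum `2`.
    calc (2 : ℝ≥0∞) ^ (3 * (e + 1)) * 2⁻¹ ^ f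
        ≤ 2 ^ (3 * (e + 1)) * 2⁻¹ ^ f * 2 ^ v :=
          le_mul_of_one_le_right' (one_le_pow₀ one_le_two)
      _ = 2 ^ (3 * (e + 1)) * 2⁻¹ ^ f * 2 ^ v * (2 * 2⁻¹) ^ (2 * v + 1) := by simp [hc]
      _ = _ := by ring
  refine (Finset.sum_le_sum fun v _ => hterm v).trans ?_
  rw [← Finset.mul_sum, ← tsum_fintype (L := .unconditional _)]
  have hinj : Function.Injective fun v : {v : Fin n // (v : ℕ) < d} => ((v : Fin n) : ℕ) :=
    Fin.val_injective.comp Subtype.val_injective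
  calc _ ≤ (2 : ℝ≥0∞) ^ (3 * d + 1) * 2⁻¹ ^ n * ∑' v : ℕ, 2⁻¹ ^ v := by
        gcongr
        exact ENNReal.tsum_comp_le_tsum_of_injective hinj _
    _ = _ := by rw [ENNReal.tsum_geometric_two]; ring

/-- Covers block size zero, where the volume bound may exceed `δ`. -/
theorem confusing_zero (n : ℕ) : confusing n 0 = ∅ := by
  refine Set.eq_empty_of_forall_notMem ?_
  rintro x ⟨A, hA, hd, -⟩
  exact hA (funext fun k => funext fun i => hd k i (Nat.zero_le _))

/-- Channel gains for which some receiver confuses inputs on the first `d` coordinates. -/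
noncomputable def outage (n d : ℕ) : Set (Fin 2 → Fin 3 → ℝ) :=
  gainBox ∩ ⋃ m : Fin 2, {g | g m ∈ confusing n d}

theorem gainBox_eq_pi :
    gainBox = Set.univ.pi fun _ : Fin 2 => Set.univ.pi fun _ : Fin 3 => Set.Ioc (1 : ℝ) 2 := by
  ext g
  simp [gainBox]

theorem measurableSet_gainBox : MeasurableSet gainBox := by
  rw [gainBox_eq_pi]
  exact MeasurableSet.univ_pi fun _ => MeasurableSet.univ_pi fun _ => measurableSet_Ioc

theorem measurableSet_outage (n d : ℕ) : MeasurableSet (outage n d) :=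
  measurableSet_gainBox.inter <| MeasurableSet.iUnion fun m =>
    measurable_pi_apply m (measurableSet_confusing n d)

theorem volume_restrict_gainBox :
    (volume : Measure (Fin 2 → Fin 3 → ℝ)).restrict gainBox
      = Measure.pi fun _ : Fin 2 => Measure.pi fun _ : Fin 3 => gainMeasure := by
  simp only [gainBox_eq_pi, volume_pi, Measure.restrict_pi_pi, gainMeasure]

theorem volume_outage_le {n d : ℕ} (hd : d ≤ n) :
    volume (outage n d) ≤ 2 ^ (3 * d + 3) * (2⁻¹ : ℝ≥0∞) ^ n := by
  rw [outage, Set.inter_comm, ← Measure.restrict_apply' measurableSet_gainBox,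
    volume_restrict_gainBox]
  refine (measure_iUnion_fintype_le _ _).trans ?_
  have h : ∀ m : Fin 2, (Measure.pi fun _ : Fin 2 => Measure.pi fun _ : Fin 3 => gainMeasure)
      {g | g m ∈ confusing n d} ≤ 2 ^ (3 * d + 2) * (2⁻¹ : ℝ≥0∞) ^ n := fun m => by
    refine le_trans (le_of_eq ?_) (pi_confusing_le hd)
    exact (measurePreserving_eval (fun _ : Fin 2 => Measure.pi fun _ : Fin 3 => gainMeasure)
      m).measure_preimage (measurableSet_confusing n d).nullMeasurableSet
  refine (Finset.sum_le_sum fun m _ => h m).trans (le_of_eq ?_)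
  rw [Fin.sum_univ_two]
  ring

/-! ### Uncoded transmission with aligned interference -/

theorem padAt_zero_injective {n d : ℕ} (hd : d ≤ n) : Function.Injective (padAt n 0 d) := by
  intro a b h
  funext i
  have := congrFun h ⟨i, i.isLt.trans_le hd⟩
  simpa [padAt] using this

theorem padAt_zero_eq_zero {n d : ℕ} (a : Fin d → ZMod 2) (i : Fin n) (hi : d ≤ (i : ℕ)) :
    padAt n 0 d a i = 0 := by
  simp [padAt, hi]

/-- Outside the confusing set, signals supported on the first `d` coordinates are recovered. -/
theorem superpose_injOn {n d : ℕ} {x : Fin 3 → ℝ} (hx : x ∉ confusing n d)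
    {A B : Fin 3 → Fin n → ZMod 2} (hA : ∀ k (i : Fin n), d ≤ (i : ℕ) → A k i = 0)
    (hB : ∀ k (i : Fin n), d ≤ (i : ℕ) → B k i = 0) (h : superpose n x A = superpose n x B) : A = B := by
  by_contra hne
  refine hx ⟨A - B, sub_ne_zero.2 hne, fun k i hi => ?_, ?_⟩
  · simp [hA k i hi, hB k i hi]
  · simp only [superpose, Pi.sub_apply, Matrix.mulVec_sub, Finset.sum_sub_distrib]
    exact sub_eq_zero.2 h

theorem exists_code_errorProb_eq_zero {n d T : ℕ} {M : Fin 2 → Fin 2 → ℕ}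
    {g : Fin 2 → Fin 3 → ℝ} (hd : d ≤ n) (hg : ∀ m, g m ∉ confusing n d)
    (e : ∀ m k, Fin (M m k) ≃ (Fin T → Fin d → ZMod 2)) :
    ∃ C : Code n T M, C.errorProb g = 0 := by
  classical
  let enc : ∀ m k : Fin 2, Fin (M m k) → Fin T → Fin n → ZMod 2 :=
    fun m k w t => padAt n 0 d (e m k w t)
  let C₀ : Code n T M := ⟨enc, fun m _ k => (e m k).symm 0⟩
  have hinj : ∀ m w w', C₀.received g w m = C₀.received g w' m → w m = w' m := by
    intro m w w' h
    let A : (∀ m k : Fin 2, Fin (M m k)) → Fin T → Fin 3 → Fin n → ZMod 2 := fun w t =>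
      ![enc (1 - m) 0 (w (1 - m) 0) t + enc (1 - m) 1 (w (1 - m) 1) t,
        enc m 0 (w m 0) t, enc m 1 (w m 1) t]
    have hA : ∀ w t k (i : Fin n), d ≤ (i : ℕ) → A w t k i = 0 := by
      intro w t k i hi
      fin_cases k <;> simp [A, enc, padAt_zero_eq_zero _ _ hi]
    have hrec : ∀ w t, C₀.received g w m t = superpose n (g m) (A w t) := by
      intro w t
      simp [C₀.received_apply, superpose, Fin.sum_univ_three, A, C₀]
    have heq : ∀ t, A w t = A w' t := fun t =>
      superpose_injOn (hg m) (hA w t) (hA w' t) (by rw [← hrec, ← hrec, h])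
    funext k
    apply (e m k).injective
    funext t
    apply padAt_zero_injective hd
    fin_cases k
    · exact congrFun (heq t) 1
    · exact congrFun (heq t) 2
  -- Any message tuple consistent with the output will do: by `hinj` all of them agree on the
  -- desired messages, even if the interfering ones differ.
  let dec : ∀ m : Fin 2, (Fin T → Fin n → ZMod 2) → ∀ k : Fin 2, Fin (M m k) := fun m y =>
    if h : ∃ w, C₀.received g w m = y then h.choose m else fun k => (e m k).symm 0
  refine ⟨⟨enc, dec⟩, ?_⟩
  have hdec : ∀ w m, dec m (C₀.received g w m) = w m := by
    intro w m
    have h : ∃ w', C₀.received g w' m = C₀.received g w m := ⟨w, rfl⟩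
    simp only [dec, dif_pos h]
    exact hinj m _ _ h.choose_spec
  rw [Code.errorProb, Finset.filter_false_of_mem, Finset.card_empty, Nat.cast_zero, zero_div]
  rintro w - ⟨m, k, hne⟩
  exact hne (congrFun (hdec w m) k)

theorem achievable_of_notMem_confusing {n d : ℕ} {g : Fin 2 → Fin 3 → ℝ} (hd : d ≤ n)
    (hg : ∀ m, g m ∉ confusing n d) : Achievable n g fun _ _ => d := by
  refine ⟨fun _ _ => Nat.cast_nonneg d, ?_⟩
  have hM : ∀ T : ℕ, ⌈(2 : ℝ) ^ ((T : ℝ) * d)⌉₊ = Fintype.card (Fin T → Fin d → ZMod 2) := by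
    intro T
    have : (2 : ℝ) ^ ((T : ℝ) * d) = ((2 ^ (d * T) : ℕ) : ℝ) := by
      rw [← Nat.cast_mul, Real.rpow_natCast, mul_comm]
      push_cast
      rfl
    rw [this, Nat.ceil_natCast]
    simp [← pow_mul]
  choose C hC using fun T : ℕ => exists_code_errorProb_eq_zero (T := T)
    (M := fun _ _ => ⌈(2 : ℝ) ^ ((T : ℝ) * d)⌉₊) hd hg
    fun _ _ => Fintype.equivOfCardEq (by rw [Fintype.card_fin, hM])
  exact ⟨C, by simp [hC]⟩

theorem le_sumCapacity {n d : ℕ} {g : Fin 2 → Fin 3 → ℝ} (hd : d ≤ n)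
    (hg : ∀ m, g m ∉ confusing n d) : (((4 * d : ℝ)) : EReal) ≤ sumCapacity n g := by
  refine le_sSup ⟨fun _ _ => d, achievable_of_notMem_confusing hd hg, ?_⟩
  congr 1
  simp only [Fin.sum_univ_two]
  ring

theorem exists_block_size {δ : ℝ} (hδ : δ ∈ Set.Ioc (0 : ℝ) 1) (n : ℕ) :
    ∃ d ≤ n, (d = 0 ∨ 2 ^ (3 * d + 3) * (2⁻¹ : ℝ≥0∞) ^ n ≤ ENNReal.ofReal δ) ∧
      4 / 3 * (n : ℝ) - 2 * Real.logb 2 (16 / δ) ≤ 4 * d := by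
  have hlog : Real.logb 2 δ ≤ 0 := Real.logb_nonpos one_lt_two hδ.1.le hδ.2
  have h16 : Real.logb 2 16 = 4 := by
    rw [show (16 : ℝ) = 2 ^ (4 : ℝ) by norm_num, Real.logb_rpow two_pos (by norm_num)]
  rw [Real.logb_div (by norm_num) hδ.1.ne', h16]
  -- Here `x` solves `2 ^ (3 * x + 3 - n) = δ`. Rounding down costs less than `4` in `4 * d`, so the
  -- total loss is at most `8 - (4 / 3) * logb 2 δ`, which is at most `2 * logb 2 (16 / δ)` as `δ ≤
  -- 1`.
  set x : ℝ := (n + Real.logb 2 δ - 3) / 3 with hx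
  have hlt : x < ⌊x⌋₊ + 1 := Nat.lt_floor_add_one x
  by_cases h0 : ⌊x⌋₊ = 0
  · refine ⟨0, Nat.zero_le _, Or.inl rfl, ?_⟩
    rw [h0, Nat.cast_zero] at hlt
    rw [Nat.cast_zero]
    linarith
  · have hle : (⌊x⌋₊ : ℝ) ≤ x := (Nat.le_floor_iff' h0).1 le_rfl
    refine ⟨⌊x⌋₊, ?_, Or.inr ?_, by linarith⟩
    · have : (⌊x⌋₊ : ℝ) ≤ n := by
        have : (0 : ℝ) ≤ n := Nat.cast_nonneg n
        linarith
      exact_mod_cast this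
    · have hreal : (2 : ℝ) ^ (3 * ⌊x⌋₊ + 3) * 2⁻¹ ^ n ≤ δ := by
        have h1 : (2 : ℝ) ^ (3 * ⌊x⌋₊ + 3) ≤ δ * 2 ^ n := by
          rw [← Real.rpow_natCast, ← Real.rpow_natCast]
          nth_rewrite 1 [← Real.rpow_logb two_pos (by norm_num) hδ.1]
          rw [← Real.rpow_add two_pos]
          refine Real.rpow_le_rpow_of_exponent_le one_le_two ?_
          push_cast
          linarith
        rw [inv_pow, ← div_eq_mul_inv, div_le_iff₀ (by positivity)]
        exact h1
      refine le_trans (le_of_eq ?_) (ENNReal.ofReal_le_ofReal hreal)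
      rw [ENNReal.ofReal_mul (by positivity), ENNReal.ofReal_pow (by norm_num),
        ENNReal.ofReal_pow (by norm_num), ENNReal.ofReal_inv_of_pos two_pos]
      simp

end XChannel

theorem theorem1 :
    ∃ c₁ : ℝ, 0 < c₁ ∧
      ∀ δ : ℝ, δ ∈ Set.Ioc (0 : ℝ) 1 → ∀ n : ℕ,
        ∃ B : Set (Fin 2 → Fin 3 → ℝ),
          B ⊆ XChannel.gainBox ∧ MeasurableSet B ∧
          MeasureTheory.volume B ≤ ENNReal.ofReal δ ∧
          ∀ g ∈ XChannel.gainBox \ B,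
            (((4 / 3 : ℝ) * (n : ℝ) - 2 * Real.logb 2 (c₁ / δ) : ℝ) : EReal)
                ≤ XChannel.sumCapacity n g ∧
            XChannel.sumCapacity n g ≤ (((4 / 3 : ℝ) * (n : ℝ) : ℝ) : EReal) := by
  refine ⟨16, by norm_num, fun δ hδ n => ?_⟩
  obtain ⟨d, hdn, hvol, hd⟩ := XChannel.exists_block_size hδ n
  refine ⟨XChannel.outage n d, Set.inter_subset_left, XChannel.measurableSet_outage n d, ?_,
    fun g hg => ⟨?_, XChannel.sumCapacity_le n g⟩⟩
  · rcases hvol with rfl | hvol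
    · simp [XChannel.outage, XChannel.confusing_zero]
    · exact (XChannel.volume_outage_le hdn).trans hvol
  · refine (EReal.coe_le_coe_iff.2 hd).trans (XChannel.le_sumCapacity hdn fun m hm => hg.2 ?_)
    exact ⟨hg.1, Set.mem_iUnion.2 ⟨m, hm⟩⟩
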